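/- Let $L\ge 0$ be an integer and let $q$ be an element of a field that satisfies $q^k\neq 1$ for every integer $k\ge 1$ (for example, an indeterminate over $\mathbb{Q}$, or a complex number with $|q|<1$). Write $(a;q)_n=\prod_{i=0}^{n-1}(1-aq^i)$ for $n\ge 0$, with the convention $1/(q^3;q^3)_k=0$ for $k<0$. Put ${N\brack k}_q=\frac{(q;q)_N}{(q;q)_k(q;q)_{N-k}}$ if $0\le k\le N$ and ${N\brack k}_q=0$ otherwise, and let $\left(\frac{\cdot}{3}\right)$ be the Jacobi symbol. Then \[ \sum_{\substack{n,m\geq0 \\ L\equiv n+2m\ (\mathrm{mod}\ 3)}} \frac{(-1)^m q^{\frac{m(m-1)}{2}+Ln} (q;q)_L}{(q;q)_m (q;q)_n (q^3;q^3)_{(L-n-2m)/3}} = \sum_{j = -\infty}^{\infty} \left(\frac{j+1}{3}\right) {2L\brack L-j}_q \] and \[ \sum_{\substack{n,m\geq0 \\ L\equiv n+2m\ (\mathrm{mod}\ 3)}} \frac{(-1)^m q^{\frac{m(m+1)}{2}+(L+1)n} (q;q)_L}{(q;q)_m (q;q)_n (q^3;q^3)_{(L-n-2m)/3}} -\sum_{\substack{n,m\geq0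 \\ L\equiv n+2m+1\ (\mathrm{mod}\ 3)}} \frac{(-1)^m q^{\frac{m(m+1)}{2}+(L+1)n} (q;q)_L}{(q;q)_m (q;q)_n (q^3;q^3)_{(L-n-2m-1)/3}} = \sum_{j = -\infty}^{\infty} \left(\frac{j+1}{3}\right) q^{L-j} {2L\brack L-j}_q . \] (All sums have only finitely many non-zero terms.) -/

import Mathlib

open scoped NumberTheorySymbols

/-- The `q`-shifted factorial `(a; q)_n = ∏_{i=0}^{n-1} (1 - a q^i)`. -/
def qPoch {K : Type*} [Field K] (a q : K) (n : ℕ) : K :=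
  ∏ i ∈ Finset.range n, (1 - a * q ^ i)

/-- The reciprocal `1 / (q; q)_k` for an integer index `k`, with the standard convention
`1 / (q; q)_k = 0` for `k < 0`. -/
def recipQFact {K : Type*} [Field K] (q : K) (k : ℤ) : K :=
  if 0 ≤ k then 1 / qPoch q q k.toNat else 0

/-- The `q`-binomial coefficient: `(q; q)_N / ((q; q)_k (q; q)_{N-k})` if `k ≥ 0` and
`N - k ≥ 0`, and `0` otherwise. -/
def qBinom {K : Type*} [Field K] (q : K) (N k : ℤ) : K :=
  if 0 ≤ k ∧ 0 ≤ N - k then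
    qPoch q q N.toNat / (qPoch q q k.toNat * qPoch q q (N - k).toNat)
  else 0

/-! Both sides satisfy the same first-order system of recurrences in L.

Left: by Euler's expansions the double sums are coefficients of Y_L(z) = (1-z)(qz^2;q)_∞ /
((z^3;q^3)_∞ (q^L z;q)_∞), read as a formal power series. With y_i = [z^i] Y_L, the first is A_L =
(q;q)_L (y_L + y_{L-1}) and the second is B_L = (q;q)_L [z^L] Y_{L+1}, where Y_{L+1} = (1 - q^L z)
Y_L.

Right: put T(N,a) = ∑_k (a-k|3) [N,k]. The right sides are T(2L,L+1) and T(2L+1,L+1). The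
Rogers–Szegő recurrence for T, combined with the symmetries of the symbol mod 3, gives T(2L+2,L+2) =
T(2L+1,L+1) - (1-q^{2L+1}) T(2L,L+1), T(2L+3,L+2) = T(2L+2,L+2) - (1-q^{2L+2}) T(2L+1,L+1)
(`jacobiBinomSum_even`, `jacobiBinomSum_odd`).

For A and B the second recurrence is immediate from Y_{L+2} = (1 - q^{L+1} z) Y_{L+1}; the first
comes from the q-difference equation of Y_L (`zcoeff_cubicSeries`). -/

open PowerSeries in
/-- The coefficient of `X ^ i` for an integer exponent `i`, which is `0` for `i < 0`. -/
noncomputable def zcoeff {K : Type*} [Field K] (f : PowerSeries K) (i : ℤ) : K :=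
  if 0 ≤ i then coeff i.toNat f else 0

/-- The series `∑ z ^ n / (q; q)_n`, which is Euler's expansion of `1 / (z; q)_∞`. -/
noncomputable def eulerInv {K : Type*} [Field K] (q : K) : PowerSeries K :=
  PowerSeries.mk fun n => 1 / qPoch q q n

/-- The series `∑ (-1) ^ m q ^ (m (m - 1) / 2) z ^ m / (q; q)_m`, which is Euler's expansion of
`(z; q)_∞`. -/
noncomputable def eulerProd {K : Type*} [Field K] (q : K) : PowerSeries K :=
  PowerSeries.mk fun m => (-1) ^ m * q ^ (m * (m - 1) / 2) / qPoch q q m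

/-! ### Euler's series, and coefficients at integer exponents -/

section

open PowerSeries

variable {K : Type*} [Field K]

theorem qPoch_succ (a q : K) (n : ℕ) : qPoch a q (n + 1) = qPoch a q n * (1 - a * q ^ n) :=
  Finset.prod_range_succ _ _

theorem qPoch_self_ne_zero {q : K} (hq : ∀ k : ℕ, 0 < k → q ^ k ≠ 1) (n : ℕ) :
    qPoch q q n ≠ 0 := by
  refine Finset.prod_ne_zero_iff.2 fun i _ h => hq (i + 1) i.succ_pos ?_
  rw [pow_succ']
  exact (sub_eq_zero.1 h).symm

theorem one_sub_pow_ne_zero {q : K} (hq : ∀ k : ℕ, 0 < k → q ^ k ≠ 1) (n : ℕ) :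
    1 - q * q ^ n ≠ 0 := by
  rw [← pow_succ']
  exact fun h => hq (n + 1) n.succ_pos (sub_eq_zero.1 h).symm

theorem pow_pow_ne_one {q : K} (hq : ∀ k : ℕ, 0 < k → q ^ k ≠ 1) {s : ℕ} (hs : 0 < s)
    (k : ℕ) (hk : 0 < k) : (q ^ s) ^ k ≠ 1 := by
  rw [← pow_mul]
  exact hq _ (Nat.mul_pos hs hk)

theorem one_sub_X_mul_eulerInv {q : K} (hq : ∀ k : ℕ, 0 < k → q ^ k ≠ 1) :
    (1 - X) * eulerInv q = rescale q (eulerInv q) := by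
  ext n
  cases n with
  | zero => simp [sub_mul, eulerInv]
  | succ n =>
    rw [sub_mul, one_mul, map_sub, coeff_succ_X_mul, coeff_rescale]
    simp only [eulerInv, coeff_mk, qPoch_succ]
    have h1 := qPoch_self_ne_zero hq n
    have h2 := one_sub_pow_ne_zero hq n
    field_simp
    ring

theorem eulerProd_eq {q : K} (hq : ∀ k : ℕ, 0 < k → q ^ k ≠ 1) :
    eulerProd q = (1 - X) * rescale q (eulerProd q) := by
  ext n
  cases n with
  | zero => rw [sub_mul, one_mul, map_sub, coeff_zero_X_mul, sub_zero, coeff_rescale, pow_zero, one_mul]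
  | succ n =>
    rw [sub_mul, one_mul, map_sub, coeff_succ_X_mul, coeff_rescale, coeff_rescale]
    have h1 := qPoch_self_ne_zero hq n
    have h2 := one_sub_pow_ne_zero hq n
    -- Pascal's rule for binom(n+1, 2) avoids reasoning about halves in ℕ.
    have h3 : (n + 1) * (n + 1 - 1) / 2 = n + n * (n - 1) / 2 := by
      simpa [Nat.choose_two_right, Nat.choose_one_right] using Nat.choose_succ_succ n 1
    simp only [eulerProd, coeff_mk, qPoch_succ, h3, pow_add, pow_one]
    generalize q ^ n = x at *
    have h4 : 1 - x * q ≠ 0 := by rwa [mul_comm]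
    field_simp
    ring

theorem rescale_expand (q : K) (s : ℕ) (hs : s ≠ 0) (f : PowerSeries K) :
    rescale q (expand s hs f) = expand s hs (rescale (q ^ s) f) := by
  ext n
  rw [coeff_rescale, coeff_expand, coeff_expand]
  split_ifs with h
  · obtain ⟨k, rfl⟩ := h
    rw [Nat.mul_div_cancel_left k (Nat.pos_of_ne_zero hs), coeff_rescale, pow_mul]
  · simp

@[simp] theorem zcoeff_natCast (f : PowerSeries K) (n : ℕ) : zcoeff f n = coeff n f := by
  simp [zcoeff]

theorem zcoeff_of_neg (f : PowerSeries K) {i : ℤ} (hi : i < 0) : zcoeff f i = 0 :=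
  if_neg (not_le.2 hi)

theorem zcoeff_add (f g : PowerSeries K) (i : ℤ) : zcoeff (f + g) i = zcoeff f i + zcoeff g i := by
  unfold zcoeff; split_ifs <;> simp

theorem zcoeff_sub (f g : PowerSeries K) (i : ℤ) : zcoeff (f - g) i = zcoeff f i - zcoeff g i := by
  unfold zcoeff; split_ifs <;> simp

theorem zcoeff_C_mul (a : K) (f : PowerSeries K) (i : ℤ) :
    zcoeff (C a * f) i = a * zcoeff f i := by
  unfold zcoeff; split_ifs <;> simp

theorem zcoeff_X_mul (f : PowerSeries K) (i : ℤ) : zcoeff (X * f) i = zcoeff f (i - 1) := by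
  rcases lt_trichotomy i 0 with h | rfl | h
  · rw [zcoeff_of_neg _ h, zcoeff_of_neg _ (by omega)]
  · simp [zcoeff]
  · obtain ⟨n, rfl⟩ : ∃ n : ℕ, i = (n : ℤ) + 1 := ⟨(i - 1).toNat, by omega⟩
    rw [add_sub_cancel_right, zcoeff_natCast]
    exact_mod_cast (zcoeff_natCast (X * f) (n + 1)).trans (coeff_succ_X_mul n f)

/-- Multiplying by q^k keeps every exponent a natural number, so q = 0 and k > n need no exception.
-/
theorem pow_mul_zcoeff_rescale (q : K) (f : PowerSeries K) (n k : ℕ) :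
    q ^ k * zcoeff (rescale q f) ((n : ℤ) - k) = q ^ n * zcoeff f ((n : ℤ) - k) := by
  rcases le_or_gt k n with h | h
  · rw [← Nat.cast_sub h, zcoeff_natCast, zcoeff_natCast, coeff_rescale, ← mul_assoc, ← pow_add,
      Nat.add_sub_cancel' h]
  · rw [zcoeff_of_neg _ (by omega), zcoeff_of_neg _ (by omega), mul_zero, mul_zero]

theorem zcoeff_expand_mul (s : ℕ) (hs : s ≠ 0) (f g : PowerSeries K) (c : ℤ) (M : ℕ)
    (hM : c < M) : zcoeff (expand s hs f * g) c =
      ∑ m ∈ Finset.range M, coeff m f * zcoeff g (c - s * m) := by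
  have hs' : 0 < s := Nat.pos_of_ne_zero hs
  rcases lt_or_ge c 0 with hc | hc
  · rw [zcoeff_of_neg _ hc, Finset.sum_eq_zero]
    intro m _
    rw [zcoeff_of_neg, mul_zero]
    have : (0 : ℤ) ≤ (s : ℤ) * m := by positivity
    omega
  · lift c to ℕ using hc
    rw [zcoeff_natCast, coeff_mul, Finset.Nat.sum_antidiagonal_eq_sum_range_succ
      (fun u v => coeff u (expand s hs f) * coeff v g)]
    symm
    refine Finset.sum_bij_ne_zero (fun m _ _ => s * m) ?_ ?_ ?_ ?_
    · intro m _ h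
      by_contra hlt
      refine h ?_
      rw [zcoeff_of_neg, mul_zero]
      rw [Finset.mem_range] at hlt
      push Not at hlt
      have : ((c + 1 : ℕ) : ℤ) ≤ ((s * m : ℕ) : ℤ) := by exact_mod_cast hlt
      push_cast at this
      omega
    · intro a _ _ b _ _ h
      exact Nat.eq_of_mul_eq_mul_left hs' h
    · intro u hu h
      have hdvd : s ∣ u := by
        by_contra hnd
        rw [coeff_expand_of_not_dvd s hs f hnd, zero_mul] at h
        exact h rfl
      obtain ⟨m, rfl⟩ := hdvd
      have hle : s * m ≤ c := Nat.lt_succ_iff.1 (Finset.mem_range.1 hu)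
      have hm : m ≤ s * m := Nat.le_mul_of_pos_left m hs'
      refine ⟨m, Finset.mem_range.2 (by omega), ?_, rfl⟩
      rwa [coeff_expand_mul, ← zcoeff_natCast g, Nat.cast_sub hle, Nat.cast_mul] at h
    · intro m _ h
      have hle : s * m ≤ c := by
        by_contra hlt
        refine h ?_
        rw [zcoeff_of_neg, mul_zero]
        have : (c : ℤ) < ((s * m : ℕ) : ℤ) := by exact_mod_cast not_le.1 hlt
        push_cast at this
        omega
      rw [coeff_expand_mul, ← zcoeff_natCast g, Nat.cast_sub hle, Nat.cast_mul]

end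

/-! ### The cubic series and its q-difference equation -/

open PowerSeries in
/-- The series `(1 - z) (q z ^ 2; q)_∞ / ((z ^ 3; q ^ 3)_∞ (q ^ L z; q)_∞)`. -/
noncomputable def cubicSeries {K : Type*} [Field K] (q : K) (L : ℕ) : PowerSeries K :=
  (1 - X) * expand 2 two_ne_zero (rescale q (eulerProd q)) *
    expand 3 three_ne_zero (eulerInv (q ^ 3)) * rescale (q ^ L) (eulerInv q)

section

open PowerSeries

variable {K : Type*} [Field K]

theorem one_sub_mul_rescale_eulerInv {q : K} (hq : ∀ k : ℕ, 0 < k → q ^ k ≠ 1) (L : ℕ) :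
    (1 - C (q ^ L) * X) * rescale (q ^ L) (eulerInv q) = rescale (q ^ (L + 1)) (eulerInv q) := by
  have h := congrArg (rescale (q ^ L)) (one_sub_X_mul_eulerInv hq)
  rwa [map_mul, map_sub, map_one, rescale_X, rescale_rescale, ← pow_succ'] at h

theorem expand_two_eulerProd {q : K} (hq : ∀ k : ℕ, 0 < k → q ^ k ≠ 1) :
    expand 2 two_ne_zero (eulerProd q) =
      (1 - X ^ 2) * expand 2 two_ne_zero (rescale q (eulerProd q)) := by
  conv_lhs => rw [eulerProd_eq hq]
  rw [map_mul, map_sub, map_one, expand_X]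

theorem one_add_X_mul_cubicSeries {q : K} (hq : ∀ k : ℕ, 0 < k → q ^ k ≠ 1) (L : ℕ) :
    (1 + X) * cubicSeries q L = expand 2 two_ne_zero (eulerProd q) *
      expand 3 three_ne_zero (eulerInv (q ^ 3)) * rescale (q ^ L) (eulerInv q) := by
  rw [expand_two_eulerProd hq, cubicSeries]
  ring

theorem one_sub_mul_cubicSeries {q : K} (hq : ∀ k : ℕ, 0 < k → q ^ k ≠ 1) (L : ℕ) :
    (1 - C (q ^ L) * X) * cubicSeries q L = cubicSeries q (L + 1) := by
  rw [cubicSeries, cubicSeries, ← one_sub_mul_rescale_eulerInv hq]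
  ring

/-- Under z ↦ qz the product (qz^2;q)_∞ loses the factors 1-qz^2 and 1-q^2z^2, while the
denominators release 1-z^3 and 1-q^L z. Cancelling 1-qz and 1-z leaves this polynomial form. -/
theorem rescale_cubicSeries {q : K} (hq : ∀ k : ℕ, 0 < k → q ^ k ≠ 1) (L : ℕ) :
    (1 - C q * X ^ 2) * (1 + C q * X) * rescale q (cubicSeries q L) =
      (1 + X + X ^ 2) * (1 - C (q ^ L) * X) * cubicSeries q L := by
  have hE (a : K) : expand 2 two_ne_zero (rescale a (eulerProd q)) =
      (1 - C a * X ^ 2) * expand 2 two_ne_zero (rescale (q * a) (eulerProd q)) := by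
    conv_lhs => rw [eulerProd_eq hq]
    rw [map_mul, map_sub, map_one, rescale_X, rescale_rescale, map_mul, map_sub, map_one,
      map_mul, expand_C, expand_X]
  have hD : rescale q (expand 3 three_ne_zero (eulerInv (q ^ 3))) =
      (1 - X ^ 3) * expand 3 three_ne_zero (eulerInv (q ^ 3)) := by
    rw [rescale_expand, ← one_sub_X_mul_eulerInv (pow_pow_ne_one hq three_pos), map_mul, map_sub,
      map_one, expand_X]
  have he : rescale q (rescale (q ^ L) (eulerInv q)) =
      (1 - C (q ^ L) * X) * rescale (q ^ L) (eulerInv q) := by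
    rw [one_sub_mul_rescale_eulerInv hq, rescale_rescale, ← pow_succ]
  rw [cubicSeries, map_mul, map_mul, map_mul, hD, he, rescale_expand, rescale_rescale, map_sub,
    map_one, rescale_X, hE q, hE (q * q), show q * q ^ 2 = q * (q * q) by ring, map_mul]
  ring

/-- The linear relation between consecutive coefficients of `cubicSeries q L` that is dictated by
its `q`-difference equation. -/
theorem zcoeff_cubicSeries {q : K} (hq : ∀ k : ℕ, 0 < k → q ^ k ≠ 1) (L : ℕ) :
    q ^ (L + 1) * (zcoeff (cubicSeries q L) (L + 1) + zcoeff (cubicSeries q L) L) =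
      zcoeff (cubicSeries q L) (L + 1) + zcoeff (cubicSeries q L) L
        + zcoeff (cubicSeries q L) (L - 1) - q ^ L * zcoeff (cubicSeries q L) L := by
  -- At exponent L+1 the terms in y_{L-2} cancel, as does -q^L y_{L-1}, because q^k q^{L+1-k} =
  -- q^{L+1} matches the factor q^L.
  have h := congrArg (zcoeff · ((L : ℤ) + 1)) (rescale_cubicSeries hq L)
  have h0 := pow_mul_zcoeff_rescale q (cubicSeries q L) (L + 1) 0
  have h1 := pow_mul_zcoeff_rescale q (cubicSeries q L) (L + 1) 1
  have h2 := pow_mul_zcoeff_rescale q (cubicSeries q L) L 1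
  have h3 := pow_mul_zcoeff_rescale q (cubicSeries q L) L 2
  generalize cubicSeries q L = Y at *
  have hl : (1 - C q * X ^ 2) * (1 + C q * X) * rescale q Y =
      rescale q Y + C q * (X * rescale q Y) - C q * (X * (X * rescale q Y))
        - C q * (C q * (X * (X * (X * rescale q Y)))) := by ring
  have hr : (1 + X + X ^ 2) * (1 - C (q ^ L) * X) * Y =
      Y + X * Y + X * (X * Y) - C (q ^ L) * (X * Y) - C (q ^ L) * (X * (X * Y))
        - C (q ^ L) * (X * (X * (X * Y))) := by ring
  rw [hl, hr] at h
  simp only [zcoeff_sub, zcoeff_add, zcoeff_C_mul, zcoeff_X_mul] at h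
  rw [show (L : ℤ) + 1 - 1 = L by ring, show (L : ℤ) - 1 - 1 = L - 2 by ring] at h
  push_cast at h0 h1 h2 h3
  rw [sub_zero] at h0
  rw [add_sub_cancel_right] at h1
  linear_combination h - h0 - h1 + h2 + h3

end

/-! ### Character sums of q-binomial coefficients -/

/-- The sum `∑ k, (a - k | 3) [N, k]_q`. -/
noncomputable def jacobiBinomSum {K : Type*} [Field K] (q : K) (N a : ℤ) : K :=
  ∑ᶠ k : ℤ, (J(a - k | 3) : K) * qBinom q N k

section

variable {K : Type*} [Field K]

theorem qBinom_of_neg (q : K) (N : ℤ) {k : ℤ} (hk : k < 0) : qBinom q N k = 0 :=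
  if_neg fun h => by omega

theorem qBinom_of_lt (q : K) {N k : ℤ} (hk : N < k) : qBinom q N k = 0 :=
  if_neg fun h => by omega

theorem qBinom_of_eq_add (q : K) {N k : ℤ} (i j : ℕ) (hk : k = i) (hN : N = i + j) :
    qBinom q N k = qPoch q q (i + j) / (qPoch q q i * qPoch q q j) := by
  have h1 : N.toNat = i + j := by omega
  have h2 : k.toNat = i := by omega
  have h3 : (N - k).toNat = j := by omega
  rw [qBinom, if_pos (by omega), h1, h2, h3]

theorem qBinom_zero_right {q : K} (hq : ∀ k : ℕ, 0 < k → q ^ k ≠ 1) (N : ℕ) :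
    qBinom q N 0 = 1 := by
  have := qPoch_self_ne_zero hq N
  rw [qBinom_of_eq_add q 0 N (by simp) (by simp)]
  rw [zero_add, show qPoch q q 0 = 1 from Finset.prod_range_zero _, one_mul, div_self this]

theorem qBinom_symm (q : K) (N k : ℤ) : qBinom q N (N - k) = qBinom q N k := by
  simp only [qBinom, sub_sub_cancel, and_comm, mul_comm]

theorem qBinom_self {q : K} (hq : ∀ k : ℕ, 0 < k → q ^ k ≠ 1) (N : ℕ) : qBinom q N N = 1 := by
  rw [← qBinom_symm, sub_self, qBinom_zero_right hq]

/-- The recurrence in the upper index behind the three-term recurrence of the Rogers–Szegő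
polynomials. -/
theorem qBinom_add_two {q : K} (hq : ∀ k : ℕ, 0 < k → q ^ k ≠ 1) (N : ℕ) (k : ℤ) :
    qBinom q (N + 2) k = qBinom q (N + 1) k + qBinom q (N + 1) (k - 1)
      - (1 - q ^ (N + 1)) * qBinom q N (k - 1) := by
  rcases lt_trichotomy k 0 with h | rfl | h
  · simp [qBinom_of_neg q _ h, qBinom_of_neg q _ (show k - 1 < 0 by omega)]
  · have h1 := qBinom_zero_right hq (N + 2)
    have h2 := qBinom_zero_right hq (N + 1)
    push_cast at h1 h2
    rw [h1, h2, qBinom_of_neg q _ (by omega), qBinom_of_neg q _ (by omega)]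
    ring
  rcases lt_trichotomy k (N + 2) with h' | rfl | h'
  -- In the interior all terms share the factor (q;q)_{i+j} / ((q;q)_i (q;q)_j), leaving a rational
  -- identity in q^i and q^j.
  · obtain ⟨i, rfl⟩ : ∃ i : ℕ, k = i + 1 := ⟨(k - 1).toNat, by omega⟩
    obtain ⟨j, rfl⟩ : ∃ j : ℕ, N = i + j := ⟨N - i, by omega⟩
    rw [qBinom_of_eq_add q (i + 1) (j + 1) (by push_cast; ring) (by push_cast; ring),
      qBinom_of_eq_add q (i + 1) j (by push_cast; ring) (by push_cast; ring),
      qBinom_of_eq_add q i (j + 1) (by ring) (by push_cast; ring),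
      qBinom_of_eq_add q i j (by ring) (Nat.cast_add i j),
      show i + 1 + (j + 1) = i + j + 1 + 1 by ring, show i + 1 + j = i + j + 1 by ring,
      show i + (j + 1) = i + j + 1 by ring]
    simp only [qPoch_succ]
    have h1 := qPoch_self_ne_zero hq i
    have h2 := qPoch_self_ne_zero hq j
    have h3 := one_sub_pow_ne_zero hq i
    have h4 := one_sub_pow_ne_zero hq j
    simp only [pow_add, pow_one] at *
    generalize q ^ i = x at *
    generalize q ^ j = y at *
    rw [← mul_div_assoc, div_add_div _ _ (by positivity) (by positivity),
      div_sub_div _ _ (by positivity) (by positivity), div_eq_div_iff (by positivity) (by positivity)]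
    ring
  · have h1 := qBinom_self hq (N + 2)
    have h2 := qBinom_self hq (N + 1)
    push_cast at h1 h2
    rw [show (N : ℤ) + 2 - 1 = N + 1 by ring, h1, h2, qBinom_of_lt q (by omega),
      qBinom_of_lt q (by omega)]
    ring
  · simp [qBinom_of_lt q h', qBinom_of_lt q (show (N : ℤ) + 1 < k by omega),
      qBinom_of_lt q (show (N : ℤ) + 1 < k - 1 by omega),
      qBinom_of_lt q (show (N : ℤ) < k - 1 by omega)]

/-- A q-Pascal rule, used to absorb the weight q^{L-j} of the second identity. -/
theorem zpow_mul_qBinom {q : K} (hq : ∀ k : ℕ, 0 < k → q ^ k ≠ 1) (N : ℕ) (k : ℤ) :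
    q ^ k * qBinom q N k = qBinom q (N + 1) k - qBinom q N (k - 1) := by
  rcases lt_trichotomy k 0 with h | rfl | h
  · simp [qBinom_of_neg q _ h, qBinom_of_neg q _ (show k - 1 < 0 by omega)]
  · have h1 := qBinom_zero_right hq (N + 1)
    push_cast at h1
    rw [h1, qBinom_zero_right hq, qBinom_of_neg q _ (by omega)]
    simp
  rcases lt_trichotomy k (N + 1) with h' | rfl | h'
  · obtain ⟨i, rfl⟩ : ∃ i : ℕ, k = i + 1 := ⟨(k - 1).toNat, by omega⟩
    obtain ⟨j, rfl⟩ : ∃ j : ℕ, N = i + 1 + j := ⟨N - (i + 1), by omega⟩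
    rw [qBinom_of_eq_add q (N := ((i + 1 + j : ℕ) : ℤ) + 1) (i + 1) (j + 1)
        (by push_cast; ring) (by push_cast; ring),
      qBinom_of_eq_add q (i + 1) j (by push_cast; ring) (Nat.cast_add (i + 1) j),
      qBinom_of_eq_add q i (j + 1) (by ring) (by push_cast; ring),
      show i + 1 + (j + 1) = i + j + 1 + 1 by ring, show i + 1 + j = i + j + 1 by ring,
      show i + (j + 1) = i + j + 1 by ring, show (i : ℤ) + 1 = ((i + 1 : ℕ) : ℤ) by push_cast; ring,
      zpow_natCast]
    simp only [qPoch_succ]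
    have h1 := qPoch_self_ne_zero hq i
    have h2 := qPoch_self_ne_zero hq j
    have h3 := one_sub_pow_ne_zero hq i
    have h4 := one_sub_pow_ne_zero hq j
    simp only [pow_add, pow_one] at *
    generalize q ^ i = x at *
    generalize q ^ j = y at *
    rw [← mul_div_assoc, div_sub_div _ _ (by positivity) (by positivity),
      div_eq_div_iff (by positivity) (by positivity)]
    ring
  · have h1 := qBinom_self hq (N + 1)
    push_cast at h1
    rw [add_sub_cancel_right, h1, qBinom_self hq, qBinom_of_lt q (by omega)]
    simp
  · simp [qBinom_of_lt q h', qBinom_of_lt q (show (N : ℤ) < k by omega),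
      qBinom_of_lt q (show (N : ℤ) < k - 1 by omega)]

theorem finite_support_mul_qBinom (q : K) (c : ℤ → K) (N d : ℤ) :
    (Function.support fun k => c k * qBinom q N (k - d)).Finite := by
  refine (Set.finite_Icc d (N + d)).subset fun k hk => ?_
  by_contra h
  refine hk ?_
  have : qBinom q N (k - d) = 0 := by
    rw [Set.mem_Icc, not_and_or, not_le, not_le] at h
    rcases h with h | h
    · exact qBinom_of_neg q _ (by omega)
    · exact qBinom_of_lt q (by omega)
  simp [this]

theorem finite_support_mul_qBinom_zero (q : K) (c : ℤ → K) (N : ℤ) :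
    (Function.support fun k => c k * qBinom q N k).Finite := by
  simpa using finite_support_mul_qBinom q c N 0

theorem jacobiBinomSum_sub_one (q : K) (N a : ℤ) :
    jacobiBinomSum q N (a - 1) = ∑ᶠ k : ℤ, (J(a - k | 3) : K) * qBinom q N (k - 1) := by
  rw [jacobiBinomSum, ← finsum_comp_equiv (Equiv.subRight (1 : ℤ))]
  refine finsum_congr fun k => ?_
  rw [Equiv.subRight_apply, sub_sub_sub_cancel_right]

theorem jacobiBinomSum_add_two {q : K} (hq : ∀ k : ℕ, 0 < k → q ^ k ≠ 1) (N : ℕ) (a : ℤ) :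
    jacobiBinomSum q (N + 2) a = jacobiBinomSum q (N + 1) a + jacobiBinomSum q (N + 1) (a - 1)
      - (1 - q ^ (N + 1)) * jacobiBinomSum q N (a - 1) := by
  rw [jacobiBinomSum_sub_one, jacobiBinomSum_sub_one, jacobiBinomSum, jacobiBinomSum,
    mul_finsum,
    ← finsum_add_distrib (finite_support_mul_qBinom_zero q _ _) (finite_support_mul_qBinom q _ _ _),
    ← finsum_sub_distrib]
  · refine finsum_congr fun k => ?_
    rw [qBinom_add_two hq]
    ring
  · exact ((finite_support_mul_qBinom_zero q _ _).union (finite_support_mul_qBinom q _ _ _)).subset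
      (Function.support_add _ _)
  · exact (finite_support_mul_qBinom q (fun k => (J(a - k | 3) : K)) N 1).subset
      (Function.support_const_smul_subset (1 - q ^ (N + 1)) _)

theorem finsum_zpow_mul_qBinom {q : K} (hq : ∀ k : ℕ, 0 < k → q ^ k ≠ 1) (N : ℕ) (a : ℤ) :
    ∑ᶠ k : ℤ, (J(a - k | 3) : K) * q ^ k * qBinom q N k =
      jacobiBinomSum q (N + 1) a - jacobiBinomSum q N (a - 1) := by
  rw [jacobiBinomSum_sub_one, jacobiBinomSum,
    ← finsum_sub_distrib (finite_support_mul_qBinom_zero q _ _) (finite_support_mul_qBinom q _ _ _)]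
  refine finsum_congr fun k => ?_
  rw [mul_assoc, zpow_mul_qBinom hq]
  ring

theorem jacobiSym_three_add_three (a : ℤ) : J(a + 3 | 3) = J(a | 3) := by
  rw [jacobiSym.mod_left, jacobiSym.mod_left a]
  congr 1
  simp

theorem jacobiSym_three_neg (a : ℤ) : J(-a | 3) = -J(a | 3) := by
  have h : J(-1 | 3) = -1 := by norm_num
  rw [← neg_one_mul, jacobiSym.mul_left, h, neg_one_mul]

theorem jacobiSym_three_sum (a : ℤ) : J(a | 3) + J(a - 1 | 3) + J(a + 1 | 3) = 0 := by
  rw [jacobiSym.mod_left a, jacobiSym.mod_left (a - 1), jacobiSym.mod_left (a + 1),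
    Int.sub_emod, Int.add_emod]
  have h1 := Int.emod_nonneg a (b := ((3 : ℕ) : ℤ)) (by decide)
  have h2 := Int.emod_lt_of_pos a (b := ((3 : ℕ) : ℤ)) (by decide)
  generalize a % ((3 : ℕ) : ℤ) = r at *
  push_cast at h2
  interval_cases r <;> norm_num

theorem jacobiBinomSum_add_three (q : K) (N a : ℤ) :
    jacobiBinomSum q N (a + 3) = jacobiBinomSum q N a :=
  finsum_congr fun k => by rw [add_sub_right_comm, jacobiSym_three_add_three]

theorem jacobiBinomSum_reflect (q : K) (N a : ℤ) :
    jacobiBinomSum q N (N - a) = -jacobiBinomSum q N a := by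
  rw [jacobiBinomSum, jacobiBinomSum, ← finsum_comp_equiv (Equiv.subLeft N),
    ← finsum_neg_distrib]
  refine finsum_congr fun k => ?_
  rw [Equiv.subLeft_apply, qBinom_symm, sub_sub_sub_cancel_left, ← neg_sub a k,
    jacobiSym_three_neg]
  push_cast
  ring

theorem jacobiBinomSum_sum (q : K) (N a : ℤ) :
    jacobiBinomSum q N a + jacobiBinomSum q N (a - 1) = -jacobiBinomSum q N (a + 1) := by
  rw [jacobiBinomSum, jacobiBinomSum, jacobiBinomSum, ← finsum_neg_distrib, ← finsum_add_distrib
    (finite_support_mul_qBinom_zero q _ _) (finite_support_mul_qBinom_zero q _ _)]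
  refine finsum_congr fun k => ?_
  have h := congrArg (Int.cast : ℤ → K) (jacobiSym_three_sum (a - k))
  rw [sub_right_comm, ← add_sub_right_comm] at h
  push_cast at h
  linear_combination qBinom q N k * h

/-- Since no division by `2` is available, antisymmetry alone does not give this. -/
theorem jacobiBinomSum_center {q : K} (hq : ∀ k : ℕ, 0 < k → q ^ k ≠ 1) (L : ℕ) :
    jacobiBinomSum q (2 * L) L = 0 := by
  induction L with
  | zero =>
    refine finsum_eq_zero_of_forall_eq_zero fun k => ?_
    rcases lt_trichotomy k 0 with h | rfl | h
    · rw [qBinom_of_neg q _ h, mul_zero]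
    · simp [jacobiSym.zero_left (b := 3) (by decide)]
    · rw [qBinom_of_lt q (by simpa using h), mul_zero]
  | succ L ih =>
    -- The first two terms on the right cancel by reflection; the third vanishes by induction.
    have h := jacobiBinomSum_add_two hq (2 * L) (L + 1)
    have h1 := jacobiBinomSum_reflect q (2 * L + 1) L
    push_cast at h ⊢
    rw [show (2 * L + 1 - L : ℤ) = L + 1 by ring] at h1
    rw [show (2 * (L + 1) : ℤ) = 2 * L + 2 by ring, h, add_sub_cancel_right, ih, h1]
    ring

theorem finsum_jacobi_mul_qBinom (q : K) (L : ℕ) :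
    ∑ᶠ j : ℤ, (J(j + 1 | 3) : K) * qBinom q (2 * L) (L - j) =
      jacobiBinomSum q (2 * L) (L + 1) := by
  rw [jacobiBinomSum, ← finsum_comp_equiv (Equiv.subLeft (L : ℤ))]
  refine finsum_congr fun j => ?_
  rw [Equiv.subLeft_apply, sub_sub_cancel, add_sub_right_comm]

theorem finsum_jacobi_mul_zpow_mul_qBinom {q : K} (hq : ∀ k : ℕ, 0 < k → q ^ k ≠ 1) (L : ℕ) :
    ∑ᶠ j : ℤ, (J(j + 1 | 3) : K) * q ^ ((L : ℤ) - j) * qBinom q (2 * L) (L - j) =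
      jacobiBinomSum q (2 * L + 1) (L + 1) := by
  have h := finsum_zpow_mul_qBinom hq (2 * L) (L + 1)
  push_cast at h
  rw [add_sub_cancel_right, jacobiBinomSum_center hq, sub_zero] at h
  rw [← h, ← finsum_comp_equiv (Equiv.subLeft (L : ℤ))]
  refine finsum_congr fun j => ?_
  rw [Equiv.subLeft_apply, sub_sub_cancel, add_sub_right_comm]

/-- Zero sum over residues, period 3 and reflection merge two terms of the recurrence into one:
T(N,L+2) + T(N,L+1) = -T(N,L+3) = -T(N,L) = T(N,L+2) for N = 2L+2. The even case is alike, with N =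
2L+1. -/
theorem jacobiBinomSum_odd {q : K} (hq : ∀ k : ℕ, 0 < k → q ^ k ≠ 1) (L : ℕ) :
    jacobiBinomSum q (2 * (L + 1) + 1) (L + 2) = jacobiBinomSum q (2 * (L + 1)) (L + 2)
      - (1 - q ^ (2 * L + 2)) * jacobiBinomSum q (2 * L + 1) (L + 1) := by
  have h := jacobiBinomSum_add_two hq (2 * L + 1) (L + 2)
  have h1 := jacobiBinomSum_sum q (2 * (L + 1)) (L + 2)
  have h2 := jacobiBinomSum_reflect q (2 * (L + 1)) (L + 2)
  have h3 := jacobiBinomSum_add_three q (2 * (L + 1)) L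
  push_cast at h
  rw [show (2 * L + 1 + 2 : ℤ) = 2 * (L + 1) + 1 by ring,
    show (2 * L + 1 + 1 : ℤ) = 2 * (L + 1) by ring, h1,
    show (L + 2 + 1 : ℤ) = L + 3 by ring, h3, show (L + 2 - 1 : ℤ) = L + 1 by ring] at h
  rw [show (2 * (L + 1) - (L + 2) : ℤ) = L by ring] at h2
  rw [h, h2]
  ring

theorem jacobiBinomSum_even {q : K} (hq : ∀ k : ℕ, 0 < k → q ^ k ≠ 1) (L : ℕ) :
    jacobiBinomSum q (2 * (L + 1)) (L + 2) = jacobiBinomSum q (2 * L + 1) (L + 1)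
      - (1 - q ^ (2 * L + 1)) * jacobiBinomSum q (2 * L) (L + 1) := by
  have h := jacobiBinomSum_add_two hq (2 * L) (L + 2)
  have h1 := jacobiBinomSum_sum q (2 * L + 1) (L + 2)
  have h2 := jacobiBinomSum_reflect q (2 * L + 1) (L + 1)
  have h3 := jacobiBinomSum_add_three q (2 * L + 1) L
  push_cast at h
  rw [show (2 * L + 2 : ℤ) = 2 * (L + 1) by ring, h1,
    show (L + 2 + 1 : ℤ) = L + 3 by ring, h3, show (L + 2 - 1 : ℤ) = L + 1 by ring] at h
  rw [show (2 * L + 1 - (L + 1) : ℤ) = L by ring] at h2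
  rw [h, h2]
  ring

theorem jacobiBinomSum_zero {q : K} (hq : ∀ k : ℕ, 0 < k → q ^ k ≠ 1) :
    jacobiBinomSum q 0 1 = 1 := by
  have h1 := qBinom_zero_right hq 0
  push_cast at h1
  rw [jacobiBinomSum, finsum_eq_single _ 0]
  · simp [h1]
  · intro k hk
    rcases lt_or_gt_of_ne hk with h | h
    · rw [qBinom_of_neg q _ h, mul_zero]
    · rw [qBinom_of_lt q h, mul_zero]

theorem jacobiBinomSum_one {q : K} (hq : ∀ k : ℕ, 0 < k → q ^ k ≠ 1) :
    jacobiBinomSum q 1 1 = 1 := by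
  have h1 := qBinom_zero_right hq 1
  push_cast at h1
  rw [jacobiBinomSum, finsum_eq_single _ 0]
  · simp [h1]
  · intro k hk
    rcases lt_or_gt_of_ne hk with h | h
    · rw [qBinom_of_neg q _ h, mul_zero]
    · rcases eq_or_lt_of_le (show 1 ≤ k by omega) with rfl | h
      · simp [jacobiSym.zero_left (b := 3) (by decide)]
      · rw [qBinom_of_lt q h, mul_zero]

end

/-! ### Double sums as coefficients, and the induction on L -/

section

open PowerSeries

variable {K : Type*} [Field K]

theorem zcoeff_expand_three_eulerInv (q : K) (i : ℤ) :
    zcoeff (expand 3 three_ne_zero (eulerInv q)) i = if 3 ∣ i then recipQFact q (i / 3) else 0 := by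
  rcases lt_or_ge i 0 with h | h
  · rw [zcoeff_of_neg _ h, recipQFact, if_neg (show ¬0 ≤ i / 3 by omega), ite_self]
  · lift i to ℕ using h
    rw [zcoeff_natCast, coeff_expand]
    by_cases hd : 3 ∣ i
    · rw [if_pos hd, if_pos (by omega), recipQFact, if_pos (by omega), eulerInv, coeff_mk]
      congr 2
    · rw [if_neg hd, if_neg (by omega)]

/-- A double sum restricted to a residue class modulo `3` as the coefficient of a product. -/
theorem finsum_modEq_eq_zcoeff (q a : K) (f g : PowerSeries K) (c : ℤ) (R : ℕ × ℕ → Prop)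
    (F : ℕ × ℕ → K) (hR : ∀ p, R p ↔ (3 : ℤ) ∣ c - p.1 - 2 * p.2)
    (hF : ∀ p, F p = a * (coeff p.2 f * coeff p.1 g * recipQFact q ((c - p.1 - 2 * p.2) / 3))) :
    ∑ᶠ (p : ℕ × ℕ) (_ : R p), F p = a * zcoeff (expand 2 two_ne_zero f *
      expand 3 three_ne_zero (eulerInv q) * g) c := by
  classical
  obtain ⟨M, hM⟩ : ∃ M : ℕ, c < M := ⟨(c + 1).toNat, by omega⟩
  -- Writing g as `expand 1` lets `zcoeff_expand_mul` extract the sum over n as well as the sum over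
  -- m.
  have hprod : expand 2 two_ne_zero f * expand 3 three_ne_zero (eulerInv q) * g =
      expand 1 one_ne_zero g * (expand 2 two_ne_zero f *
        expand 3 three_ne_zero (eulerInv q)) := by
    rw [expand_one_apply, mul_comm]
  rw [hprod, zcoeff_expand_mul 1 _ _ _ c M hM, finsum_eq_sum_of_support_subset
    (s := Finset.range M ×ˢ Finset.range M), Finset.sum_product, Finset.mul_sum]
  · refine Finset.sum_congr rfl fun n _ => ?_
    rw [zcoeff_expand_mul 2 _ _ _ _ M (by push_cast; omega), Finset.mul_sum, Finset.mul_sum]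
    refine Finset.sum_congr rfl fun m _ => ?_
    rw [finsum_eq_if, hF, zcoeff_expand_three_eulerInv]
    simp only [hR]
    push_cast
    rw [one_mul]
    split_ifs <;> ring
  · intro p hp
    rw [Function.mem_support, finsum_eq_if, hF] at hp
    -- Nonnegativity forces n + 2m ≤ c < M, so the support lies in the box.
    have h : 0 ≤ (c - p.1 - 2 * p.2) / 3 := by
      by_contra h
      simp [recipQFact, h] at hp
    simp only [Finset.coe_product, Set.mem_prod, Finset.coe_range, Set.mem_Iio]
    omega

theorem finsum_eq_zcoeff_cubicSeries {q : K} (hq : ∀ k : ℕ, 0 < k → q ^ k ≠ 1) (L : ℕ) :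
    (∑ᶠ (p : ℕ × ℕ) (_ : (L : ℤ) ≡ (p.1 : ℤ) + 2 * (p.2 : ℤ) [ZMOD 3]),
        (-1) ^ p.2 * q ^ (p.2 * (p.2 - 1) / 2 + L * p.1) * qPoch q q L
          / (qPoch q q p.2 * qPoch q q p.1)
          * recipQFact (q ^ 3) (((L : ℤ) - p.1 - 2 * p.2) / 3)) =
      qPoch q q L * (zcoeff (cubicSeries q L) L + zcoeff (cubicSeries q L) (L - 1)) := by
  rw [← zcoeff_X_mul, ← zcoeff_add, ← one_add_mul, one_add_X_mul_cubicSeries hq]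
  refine finsum_modEq_eq_zcoeff _ _ _ _ _ _ _ (fun p => ?_) (fun p => ?_)
  · rw [Int.modEq_iff_dvd]
    omega
  · rw [eulerProd, coeff_mk, coeff_rescale, eulerInv, coeff_mk, ← pow_mul, pow_add]
    have h1 := qPoch_self_ne_zero hq p.1
    have h2 := qPoch_self_ne_zero hq p.2
    field_simp

theorem finsum_sub_finsum_eq_zcoeff_cubicSeries {q : K} (hq : ∀ k : ℕ, 0 < k → q ^ k ≠ 1) (L : ℕ) :
    (∑ᶠ (p : ℕ × ℕ) (_ : (L : ℤ) ≡ (p.1 : ℤ) + 2 * (p.2 : ℤ) [ZMOD 3]),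
        (-1) ^ p.2 * q ^ (p.2 * (p.2 + 1) / 2 + (L + 1) * p.1) * qPoch q q L
          / (qPoch q q p.2 * qPoch q q p.1)
          * recipQFact (q ^ 3) (((L : ℤ) - p.1 - 2 * p.2) / 3))
      - (∑ᶠ (p : ℕ × ℕ) (_ : (L : ℤ) ≡ (p.1 : ℤ) + 2 * (p.2 : ℤ) + 1 [ZMOD 3]),
        (-1) ^ p.2 * q ^ (p.2 * (p.2 + 1) / 2 + (L + 1) * p.1) * qPoch q q L
          / (qPoch q q p.2 * qPoch q q p.1)
          * recipQFact (q ^ 3) (((L : ℤ) - p.1 - 2 * p.2 - 1) / 3)) =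
      qPoch q q L * zcoeff (cubicSeries q (L + 1)) L := by
  have hcoeff (p : ℕ × ℕ) (r : K) :
      (-1) ^ p.2 * q ^ (p.2 * (p.2 + 1) / 2 + (L + 1) * p.1) * qPoch q q L
          / (qPoch q q p.2 * qPoch q q p.1) * r = qPoch q q L *
        (coeff p.2 (rescale q (eulerProd q)) *
          coeff p.1 (rescale (q ^ (L + 1)) (eulerInv q)) * r) := by
    have h1 := qPoch_self_ne_zero hq p.1
    have h2 := qPoch_self_ne_zero hq p.2
    have h3 : p.2 * (p.2 + 1) / 2 = p.2 + p.2 * (p.2 - 1) / 2 := by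
      simpa [Nat.choose_two_right, Nat.choose_one_right, mul_comm] using
        Nat.choose_succ_succ p.2 1
    rw [coeff_rescale, eulerProd, coeff_mk, coeff_rescale, eulerInv, coeff_mk, ← pow_mul, h3,
      pow_add, pow_add]
    field_simp
  -- The factor 1-z accounts for the difference of the two sums: the second is the first with its
  -- coefficient index lowered by one.
  have hs : cubicSeries q (L + 1) = expand 2 two_ne_zero (rescale q (eulerProd q)) *
        expand 3 three_ne_zero (eulerInv (q ^ 3)) * rescale (q ^ (L + 1)) (eulerInv q)
      - X * (expand 2 two_ne_zero (rescale q (eulerProd q)) *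
        expand 3 three_ne_zero (eulerInv (q ^ 3)) * rescale (q ^ (L + 1)) (eulerInv q)) := by
    rw [cubicSeries]
    ring
  rw [hs, zcoeff_sub, zcoeff_X_mul, mul_sub]
  congr 1
  · refine finsum_modEq_eq_zcoeff _ _ _ _ _ _ _ (fun p => ?_) (fun p => hcoeff p _)
    rw [Int.modEq_iff_dvd]
    omega
  · refine finsum_modEq_eq_zcoeff _ _ _ _ _ _ _ (fun p => ?_) (fun p => ?_)
    · rw [Int.modEq_iff_dvd]
      omega
    · rw [hcoeff, show (L : ℤ) - p.1 - 2 * p.2 - 1 = L - 1 - p.1 - 2 * p.2 by ring]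

theorem zcoeff_cubicSeries_succ {q : K} (hq : ∀ k : ℕ, 0 < k → q ^ k ≠ 1) (L : ℕ) (i : ℤ) :
    zcoeff (cubicSeries q (L + 1)) i =
      zcoeff (cubicSeries q L) i - q ^ L * zcoeff (cubicSeries q L) (i - 1) := by
  rw [← one_sub_mul_cubicSeries hq, sub_mul, one_mul, mul_assoc, zcoeff_sub, zcoeff_C_mul,
    zcoeff_X_mul]

theorem coeff_zero_cubicSeries (q : K) (L : ℕ) : coeff 0 (cubicSeries q L) = 1 := by
  have h1 (a : K) : constantCoeff (eulerInv a) = 1 := by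
    rw [← coeff_zero_eq_constantCoeff_apply, eulerInv, coeff_mk]
    simp [qPoch]
  have h2 : constantCoeff (eulerProd q) = 1 := by
    rw [← coeff_zero_eq_constantCoeff_apply, eulerProd, coeff_mk]
    simp [qPoch]
  have h3 (a : K) (f : PowerSeries K) : constantCoeff (rescale a f) = constantCoeff f := by
    rw [← coeff_zero_eq_constantCoeff_apply, coeff_rescale, pow_zero, one_mul,
      coeff_zero_eq_constantCoeff_apply]
  rw [coeff_zero_eq_constantCoeff_apply, cubicSeries]
  simp only [map_mul, map_sub, map_one, constantCoeff_X, constantCoeff_expand, h1, h2, h3]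
  ring

theorem zcoeff_cubicSeries_eq_jacobiBinomSum {q : K} (hq : ∀ k : ℕ, 0 < k → q ^ k ≠ 1) (L : ℕ) :
    qPoch q q L * (zcoeff (cubicSeries q L) L + zcoeff (cubicSeries q L) (L - 1)) =
        jacobiBinomSum q (2 * L) (L + 1) ∧
      qPoch q q L * zcoeff (cubicSeries q (L + 1)) L = jacobiBinomSum q (2 * L + 1) (L + 1) := by
  induction L with
  | zero =>
    have h (L : ℕ) : zcoeff (cubicSeries q L) 0 = 1 := by
      rw [← coeff_zero_cubicSeries q L]
      exact zcoeff_natCast _ 0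
    simp [h, qPoch, jacobiBinomSum_zero hq, jacobiBinomSum_one hq,
      zcoeff_of_neg _ (show (-1 : ℤ) < 0 by decide)]
  | succ L ih =>
    obtain ⟨ih1, ih2⟩ := ih
    have he := jacobiBinomSum_even hq L
    have ho := jacobiBinomSum_odd hq L
    have hz := zcoeff_cubicSeries hq L
    rw [← ih1, ← ih2] at he
    have key : qPoch q q (L + 1) * (zcoeff (cubicSeries q (L + 1)) (L + 1)
        + zcoeff (cubicSeries q (L + 1)) L) = jacobiBinomSum q (2 * (L + 1)) (L + 2) := by
      rw [he, qPoch_succ]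
      simp only [zcoeff_cubicSeries_succ hq, add_sub_cancel_right]
      linear_combination (-qPoch q q L) * hz
    rw [← ih2, ← key] at ho
    push_cast
    rw [add_sub_cancel_right, add_assoc (L : ℤ) 1 1, one_add_one_eq_two, key, ho, ← key]
    refine ⟨rfl, ?_⟩
    -- What remains is (1-q^{L+1})(1+q^{L+1}) = 1-q^{2L+2}.
    rw [zcoeff_cubicSeries_succ hq (L + 1), add_sub_cancel_right, qPoch_succ]
    ring

end

/-- All four sums are sums of finitely supported families: the left-hand sides because
`recipQFact` vanishes at negative indices, the right-hand sides because `qBinom` vanishes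
outside `-L ≤ j ≤ L`. The integer divisions by `3` are exact by the summation conditions. -/
theorem mainTheorem10 {K : Type*} [Field K] (q : K) (hq : ∀ k : ℕ, 0 < k → q ^ k ≠ 1) (L : ℕ) :
    (∑ᶠ (p : ℕ × ℕ) (_ : (L : ℤ) ≡ (p.1 : ℤ) + 2 * (p.2 : ℤ) [ZMOD 3]),
        (-1) ^ p.2 * q ^ (p.2 * (p.2 - 1) / 2 + L * p.1) * qPoch q q L
          / (qPoch q q p.2 * qPoch q q p.1)
          * recipQFact (q ^ 3) (((L : ℤ) - p.1 - 2 * p.2) / 3)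
      = ∑ᶠ j : ℤ, (J(j + 1 | 3) : K) * qBinom q (2 * L) (L - j))
    ∧
    ((∑ᶠ (p : ℕ × ℕ) (_ : (L : ℤ) ≡ (p.1 : ℤ) + 2 * (p.2 : ℤ) [ZMOD 3]),
        (-1) ^ p.2 * q ^ (p.2 * (p.2 + 1) / 2 + (L + 1) * p.1) * qPoch q q L
          / (qPoch q q p.2 * qPoch q q p.1)
          * recipQFact (q ^ 3) (((L : ℤ) - p.1 - 2 * p.2) / 3))
      - (∑ᶠ (p : ℕ × ℕ) (_ : (L : ℤ) ≡ (p.1 : ℤ) + 2 * (p.2 : ℤ) + 1 [ZMOD 3]),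
        (-1) ^ p.2 * q ^ (p.2 * (p.2 + 1) / 2 + (L + 1) * p.1) * qPoch q q L
          / (qPoch q q p.2 * qPoch q q p.1)
          * recipQFact (q ^ 3) (((L : ℤ) - p.1 - 2 * p.2 - 1) / 3))
      = ∑ᶠ j : ℤ, (J(j + 1 | 3) : K) * q ^ ((L : ℤ) - j) * qBinom q (2 * L) (L - j)) := by
  rw [finsum_eq_zcoeff_cubicSeries hq, finsum_sub_finsum_eq_zcoeff_cubicSeries hq, finsum_jacobi_mul_qBinom,
    finsum_jacobi_mul_zpow_mul_qBinom hq]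
  exact zcoeff_cubicSeries_eq_jacobiBinomSum hq L
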